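/- A contact algebra $(B,C)$ is a Boolean algebra $B=(B,0,1,\vee,\wedge,{}^*)$ ($0=1$ is allowed) with a binary relation $C$ on $B$ such that, for all $a,b,c\in B$: (C1) if $a\neq 0$ then $aCa$; (C2) if $aCb$ then $a\neq 0$ and $b\neq 0$; (C3) $aCb$ implies $bCa$; (C4) $aC(b\vee c)$ iff $aCb$ or $aCc$. It is a complete normal contact algebra if moreover $B$ is complete and: (C5) if not $aCb$, then there is $c\in B$ with neither $aCc$ nor $bCc^*$; (C6) if $a\neq 1$, then there is $b\neq 0$ for which $bCa$ fails. Let $\mathbf{OpC}$ be the category of all compact Hausdorff spaces and all open maps (continuous, not necessarily surjective) between them, with the usual composition. Let $\mathbf{DOpC}$ be the category whose objects are all complete normal contact algebras and whose morphisms $\varphi:(A,C)\to(B,C')$ are all complete Boolean homomorphisms $\varphi:A\to B$ (Boolean homomorphisms preserving arbitrary joins and meets) such that (F1) for all $a,b\in A$, $\varphi(a)C'\varphi(b)$ implies $aCb$; (CO) for all $a\in A$ and $b\in B$, $aC\varphi_\Lambda(b)$ implies $\varphi(a)C'b$, where $\varphi_\Lambda:B\to A$ is the left adjoint of $\varphi$,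 i.e. the unique map such that $b\le\varphi(a)$ iff $\varphi_\Lambda(b)\le a$ for all $a\in A$, $b\in B$; composition is composition of maps. Then the categories $\mathbf{OpC}$ and $\mathbf{DOpC}$ are dually equivalent. -/

import Mathlib

open CategoryTheory

universe u

/-- `C` is a contact relation on the Boolean algebra `B`, i.e. `(B, C)` is a contact algebra. -/
structure IsContact {B : Type u} [BooleanAlgebra B] (C : B → B → Prop) : Prop where
  /-- (C1) -/
  refl_of_ne_bot : ∀ a : B, a ≠ ⊥ → C a a
  /-- (C2) -/
  ne_bot : ∀ a b : B, C a b → a ≠ ⊥ ∧ b ≠ ⊥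
  /-- (C3) -/
  symm : ∀ a b : B, C a b → C b a
  /-- (C4) -/
  sup_right : ∀ a b c : B, C a (b ⊔ c) ↔ C a b ∨ C a c

/-- `(B, C)` is a normal contact algebra. -/
structure IsNormalContact {B : Type u} [BooleanAlgebra B] (C : B → B → Prop) : Prop
    extends IsContact C where
  /-- (C5) -/
  interpolate : ∀ a b : B, ¬ C a b → ∃ c : B, ¬ C a c ∧ ¬ C b cᶜ
  /-- (C6) -/
  exists_ne_bot : ∀ a : B, a ≠ ⊤ → ∃ b : B, b ≠ ⊥ ∧ ¬ C b a

/-- Complete normal contact algebras (the Boolean algebra with one element is allowed). -/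
structure CNCA : Type (u + 1) where
  /-- The underlying set. -/
  carrier : Type u
  [str : CompleteBooleanAlgebra carrier]
  /-- The contact relation. -/
  contact : carrier → carrier → Prop
  isNormalContact : IsNormalContact contact

attribute [instance] CNCA.str

/-- The left adjoint `φ_Λ : B → A` of a complete Boolean homomorphism `φ : A → B`;
it is characterized by `gc_lowerAdj` below. -/
def lowerAdj {A B : Type u} [CompleteBooleanAlgebra A] [CompleteBooleanAlgebra B]
    (φ : CompleteLatticeHom A B) (b : B) : A :=
  sInf {a : A | b ≤ φ a}

theorem gc_lowerAdj {A B : Type u} [CompleteBooleanAlgebra A] [CompleteBooleanAlgebra B]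
    (φ : CompleteLatticeHom A B) : GaloisConnection (lowerAdj φ) φ := by
  intro b a
  constructor
  · intro h
    have h1 : b ≤ φ (lowerAdj φ b) := by
      rw [lowerAdj, map_sInf]
      refine le_sInf ?_
      rintro _ ⟨x, hx, rfl⟩
      exact hx
    exact h1.trans (OrderHomClass.mono φ h)
  · intro h
    exact sInf_le h

theorem lowerAdj_id {A : Type u} [CompleteBooleanAlgebra A] (a : A) :
    lowerAdj (CompleteLatticeHom.id A) a = a :=
  le_antisymm (sInf_le (le_refl a)) (le_sInf fun _ h => h)

theorem lowerAdj_comp {A B D : Type u} [CompleteBooleanAlgebra A] [CompleteBooleanAlgebra B]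
    [CompleteBooleanAlgebra D] (ψ : CompleteLatticeHom B D) (φ : CompleteLatticeHom A B) (d : D) :
    lowerAdj (ψ.comp φ) d = lowerAdj φ (lowerAdj ψ d) := by
  refine eq_of_forall_ge_iff fun a => ?_
  rw [gc_lowerAdj (ψ.comp φ) d a, gc_lowerAdj φ _ a, gc_lowerAdj ψ d _]
  rfl

/-- Fedorchuk morphisms of complete normal contact algebras: complete Boolean homomorphisms
(maps preserving arbitrary joins and meets, hence also `0`, `1` and complements) which
reflect the contact relation. -/
@[ext]
structure FedorchukHom (A B : CNCA.{u}) where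
  /-- The underlying complete Boolean homomorphism. -/
  toHom : CompleteLatticeHom A.carrier B.carrier
  /-- (F1) -/
  contact_of_map : ∀ a b : A.carrier, B.contact (toHom a) (toHom b) → A.contact a b

/-- The category `DSkeC` of complete normal contact algebras and Fedorchuk morphisms. -/
instance CNCA.category : Category.{u} CNCA.{u} where
  Hom A B := FedorchukHom A B
  id A := ⟨CompleteLatticeHom.id A.carrier, fun _ _ h => h⟩
  comp f g := ⟨g.toHom.comp f.toHom,
    fun a b h => f.contact_of_map a b (g.contact_of_map _ _ h)⟩

/-- Condition (CO): `a C φ_Λ(b)` implies `φ(a) C' b`. -/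
def CNCA.CO : MorphismProperty CNCA.{u} := fun A B φ =>
  ∀ (a : A.carrier) (b : B.carrier),
    A.contact a (lowerAdj (FedorchukHom.toHom φ) b) → B.contact (FedorchukHom.toHom φ a) b

instance CNCA.isMultiplicative_CO : CNCA.CO.{u}.IsMultiplicative where
  id_mem A := by
    intro a b h
    have h' : A.contact a (lowerAdj (CompleteLatticeHom.id A.carrier) b) := h
    rw [lowerAdj_id] at h'
    exact h'
  comp_mem {A B D} f g hf hg := by
    intro a d h
    have h' : A.contact a
        (lowerAdj ((FedorchukHom.toHom g).comp (FedorchukHom.toHom f)) d) := h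
    rw [lowerAdj_comp] at h'
    exact hg _ _ (hf _ _ h')

/-- The category `DOpC` of complete normal contact algebras and Fedorchuk morphisms
satisfying (CO). -/
abbrev DOpC : Type (u + 1) := WideSubcategory CNCA.CO.{u}

/-- The property of being an open map, for continuous maps of compact Hausdorff spaces. -/
def CompHaus.openMaps : MorphismProperty CompHaus.{u} := fun _ _ f => IsOpenMap f

instance CompHaus.isMultiplicative_openMaps : CompHaus.openMaps.{u}.IsMultiplicative where
  id_mem _ := IsOpenMap.id
  comp_mem {X Y Z} f g hf hg := by
    have hf' : IsOpenMap (f : X → Y) := hf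
    have hg' : IsOpenMap (g : Y → Z) := hg
    exact hg'.comp hf'

/-- The category `OpC` of compact Hausdorff spaces and open (continuous) maps. -/
abbrev OpC : Type (u + 1) := WideSubcategory CompHaus.openMaps.{u}

/-! A compact Hausdorff space goes to its regular closed sets, with contact meaning nonempty
intersection; an open map `f` goes to preimage under `f`, whose left adjoint is direct image. This
functor is shown to be faithful, full and essentially surjective.

Faithful: regular closed neighbourhoods separate points.

Full: given `φ` and a point `x`, the `F` with `x ∈ φ F` form a clan by (F1), and compactness gives
it a common point, taken as `f x` (`exists_mem_of_isClan`). (CO) upgrades `x ∈ φ F → f x ∈ F` to an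
equivalence and identifies the image of `G` with `lowerAdj φ G`, which forces `f` to be open.

Essentially surjective: the points of an abstract algebra are its clusters. Contacting elements lie
in a common clan (two prime ideal extensions), and (C5) enlarges clans to clusters and separates
clusters. (C6) makes `a ↦ {σ | a ∈ σ}` an order embedding into regular closed sets; completeness of
the algebra makes it onto. -/

/-- The type of regular closed subsets of a topological space. -/
structure RegularClosed (X : Type u) [TopologicalSpace X] : Type u where
  /-- The underlying set. -/
  carrier : Set X
  /-- The set is the closure of its interior. -/
  closure_interior' : closure (interior carrier) = carrier

/-! ### The normal contact algebra of regular closed sets. -/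

namespace RegularClosed

open Set

variable {X : Type u} [TopologicalSpace X]

instance : SetLike (RegularClosed X) X where
  coe F := F.1
  coe_injective F G h := by cases F; cases G; congr

theorem closure_interior (F : RegularClosed X) : closure (interior (F : Set X)) = F :=
  F.closure_interior'

theorem isClosed (F : RegularClosed X) : IsClosed (F : Set X) := by
  rw [← F.closure_interior]; exact isClosed_closure

/-- The closure of an open set, as a regular closed set. -/
def ofIsOpen (U : Set X) (hU : IsOpen U) : RegularClosed X :=
  ⟨closure U, subset_antisymm
    (closure_minimal interior_subset isClosed_closure)
    (closure_mono (interior_maximal subset_closure hU))⟩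

@[simp]
theorem coe_ofIsOpen (U : Set X) (hU : IsOpen U) : (ofIsOpen U hU : Set X) = closure U := rfl

theorem subset_closure_interior (F : RegularClosed X) {S : Set X} (h : (F : Set X) ⊆ S) :
    (F : Set X) ⊆ closure (interior S) :=
  F.closure_interior.symm.subset.trans (closure_mono (interior_mono h))

theorem closure_interior_subset {S : Set X} (hS : IsClosed S) : closure (interior S) ⊆ S :=
  closure_minimal interior_subset hS

theorem closure_interior_union (F G : RegularClosed X) :
    closure (interior ((F : Set X) ∪ G)) = (F : Set X) ∪ G :=
  subset_antisymm (closure_interior_subset (F.isClosed.union G.isClosed))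
    (union_subset (F.subset_closure_interior subset_union_left)
      (G.subset_closure_interior subset_union_right))

instance : PartialOrder (RegularClosed X) := PartialOrder.ofSetLike _ _

theorem le_def {F G : RegularClosed X} : F ≤ G ↔ (F : Set X) ⊆ G := Iff.rfl

instance : Max (RegularClosed X) := ⟨fun F G => ⟨(F : Set X) ∪ G, closure_interior_union F G⟩⟩
instance : Min (RegularClosed X) := ⟨fun F G => ofIsOpen (interior ((F : Set X) ∩ G)) isOpen_interior⟩
instance : Top (RegularClosed X) := ⟨⟨univ, by simp⟩⟩
instance : Bot (RegularClosed X) := ⟨⟨∅, by simp⟩⟩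
instance : Compl (RegularClosed X) := ⟨fun F => ofIsOpen (F : Set X)ᶜ F.isClosed.isOpen_compl⟩
instance : SupSet (RegularClosed X) :=
  ⟨fun S => ofIsOpen (⋃ F ∈ S, interior (F : Set X))
    (isOpen_biUnion fun _ _ => isOpen_interior)⟩
instance : InfSet (RegularClosed X) :=
  ⟨fun S => ofIsOpen (interior (⋂ F ∈ S, (F : Set X))) isOpen_interior⟩

@[simp] theorem coe_sup (F G : RegularClosed X) : (↑(F ⊔ G) : Set X) = ↑F ∪ ↑G := rfl
@[simp] theorem coe_top : ((⊤ : RegularClosed X) : Set X) = univ := rfl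
@[simp] theorem coe_bot : ((⊥ : RegularClosed X) : Set X) = ∅ := rfl
theorem coe_compl (F : RegularClosed X) : (↑Fᶜ : Set X) = closure (↑F)ᶜ := rfl
theorem coe_sSup (S : Set (RegularClosed X)) :
    (↑(sSup S) : Set X) = closure (⋃ F ∈ S, interior (F : Set X)) := rfl
theorem coe_sInf (S : Set (RegularClosed X)) :
    (↑(sInf S) : Set X) = closure (interior (⋂ F ∈ S, (F : Set X))) := rfl

theorem mem_compl {F : RegularClosed X} {x : X} : x ∈ Fᶜ ↔ x ∉ interior (F : Set X) := by
  rw [← SetLike.mem_coe, coe_compl, closure_compl, mem_compl_iff]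

theorem mem_sup {F G : RegularClosed X} {x : X} : x ∈ F ⊔ G ↔ x ∈ F ∨ x ∈ G := Iff.rfl

theorem mem_top (x : X) : x ∈ (⊤ : RegularClosed X) := trivial

theorem ne_bot_iff {F : RegularClosed X} : F ≠ ⊥ ↔ (F : Set X).Nonempty := by
  rw [nonempty_iff_ne_empty, ← coe_bot, SetLike.coe_injective.ne_iff]

instance : CompleteLattice (RegularClosed X) where
  sup := max
  le_sup_left _ _ := subset_union_left
  le_sup_right _ _ := subset_union_right
  sup_le _ _ _ h1 h2 := union_subset h1 h2
  inf := min
  inf_le_left F G := (closure_interior_subset (F.isClosed.inter G.isClosed)).trans inter_subset_left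
  inf_le_right F G := (closure_interior_subset (F.isClosed.inter G.isClosed)).trans inter_subset_right
  le_inf F _ _ h1 h2 := F.subset_closure_interior (subset_inter h1 h2)
  isLUB_sSup S := by
    refine ⟨fun F hF => ?_, fun G hG => ?_⟩
    · rw [le_def, ← F.closure_interior]
      exact closure_mono
        (subset_biUnion_of_mem (u := fun F : RegularClosed X => interior (F : Set X)) hF)
    · exact closure_minimal (iUnion₂_subset fun F hF => interior_subset.trans (hG hF)) G.isClosed
  isGLB_sInf S := by
    refine ⟨fun F hF => ?_, fun G hG => ?_⟩
    · exact (closure_interior_subset (isClosed_biInter fun F _ => F.isClosed)).trans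
        (biInter_subset_of_mem hF)
    · exact G.subset_closure_interior (subset_iInter₂ fun F hF => hG hF)
  le_top _ := subset_univ _
  bot_le _ := empty_subset _

instance : CompleteBooleanAlgebra (RegularClosed X) where
  le_sup_inf F G H := by
    have hF := F.isClosed
    change closure (interior ((↑F ∪ ↑G) ∩ (↑F ∪ ↑H))) ⊆ (F : Set X) ∪ closure (interior (↑G ∩ ↑H))
    rw [← union_inter_distrib_left]
    refine closure_minimal (fun x hx => ?_) (hF.union isClosed_closure)
    by_cases hxF : x ∈ (F : Set X)
    · exact Or.inl hxF
    -- Off the closed set `F`, the interior of `F ∪ (G ∩ H)` is an open set contained in `G ∩ H`.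
    · refine Or.inr (subset_closure (mem_interior.2
        ⟨interior (↑F ∪ (↑G ∩ ↑H)) ∩ (↑F)ᶜ, ?_, isOpen_interior.inter hF.isOpen_compl, hx, hxF⟩))
      rintro y ⟨hy, hyF⟩
      exact (interior_subset hy).resolve_left hyF
  inf_compl_le_bot F := by
    change closure (interior (↑F ∩ closure (↑F)ᶜ)) ⊆ (∅ : Set X)
    rw [interior_inter, closure_compl, interior_compl, F.closure_interior,
      eq_empty_of_forall_notMem fun x (hx : x ∈ interior (F : Set X) ∩ (↑F)ᶜ) =>
        hx.2 (interior_subset hx.1), closure_empty]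
  top_le_sup_compl F := by
    rintro x -
    by_cases hx : x ∈ F
    · exact Or.inl hx
    · exact Or.inr (subset_closure hx)

/-- Two regular closed sets are in contact if they intersect. -/
def Contact (F G : RegularClosed X) : Prop := ((F : Set X) ∩ G).Nonempty

/-- By regularity, the closure of the interior of a closed neighbourhood works. This is what lets
regular closed sets stand in for open ones below. -/
theorem exists_subset_of_mem_isOpen [RegularSpace X] {x : X} {U : Set X} (hU : IsOpen U)
    (hx : x ∈ U) : ∃ F : RegularClosed X, x ∈ interior (F : Set X) ∧ (F : Set X) ⊆ U := by
  obtain ⟨K, hK, hKc, hKU⟩ := exists_mem_nhds_isClosed_subset (hU.mem_nhds hx)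
  exact ⟨ofIsOpen (interior K) isOpen_interior,
    interior_maximal subset_closure isOpen_interior (mem_interior_iff_mem_nhds.2 hK),
    (closure_interior_subset hKc).trans hKU⟩

theorem isNormalContact_contact [CompactSpace X] [T2Space X] :
    IsNormalContact (Contact : RegularClosed X → RegularClosed X → Prop) where
  refl_of_ne_bot F hF := by
    rw [Contact, inter_self]; exact ne_bot_iff.1 hF
  ne_bot F G h := ⟨ne_bot_iff.2 (h.mono inter_subset_left), ne_bot_iff.2 (h.mono inter_subset_right)⟩
  symm F G h := by rwa [Contact, inter_comm]
  sup_right F G H := by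
    simp only [Contact, coe_sup, inter_union_distrib_left, union_nonempty]
  interpolate F G h := by
    have hd : (G : Set X) ⊆ (↑F)ᶜ := fun x hG hF => h ⟨x, hF, hG⟩
    obtain ⟨U, hU, hGU, hUF⟩ := normal_exists_closure_subset G.isClosed F.isClosed.isOpen_compl hd
    refine ⟨ofIsOpen U hU, ?_, ?_⟩
    · rintro ⟨x, hxF, hxU⟩
      exact hUF hxU hxF
    · rintro ⟨x, hxG, hxU⟩
      exact mem_compl.1 hxU (interior_maximal subset_closure hU (hGU hxG))
  exists_ne_bot F hF := by
    have : ∃ x, x ∉ F := by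
      by_contra! h
      exact hF (SetLike.coe_injective (eq_univ_of_forall h))
    obtain ⟨x, hx⟩ := this
    obtain ⟨G, hxG, hGF⟩ := exists_subset_of_mem_isOpen F.isClosed.isOpen_compl hx
    exact ⟨G, ne_bot_iff.2 ⟨x, interior_subset hxG⟩, fun ⟨y, hyG, hyF⟩ => hGF hyG hyF⟩

theorem eq_of_forall_mem_imp [T3Space X] {x y : X} (h : ∀ F : RegularClosed X, x ∈ F → y ∈ F) :
    x = y := by
  by_contra hxy
  obtain ⟨F, hxF, hF⟩ := exists_subset_of_mem_isOpen (isOpen_compl_singleton (x := y)) hxy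
  exact hF (h F (interior_subset hxF)) rfl

variable {Y : Type u} [TopologicalSpace Y]

/-- Preimages under an open continuous map, as a complete Boolean homomorphism. -/
def preimage (f : X → Y) (hf : Continuous f) (ho : IsOpenMap f) :
    CompleteLatticeHom (RegularClosed Y) (RegularClosed X) where
  toFun F := ⟨f ⁻¹' F, by
    -- Taking preimages under an open continuous map commutes with interior and closure.
    rw [← ho.preimage_interior_eq_interior_preimage hf,
      ← ho.preimage_closure_eq_closure_preimage hf, F.closure_interior]⟩
  map_sInf' S := by
    refine SetLike.coe_injective ?_
    change f ⁻¹' ((sInf S : RegularClosed Y) : Set Y) = ((sInf _ : RegularClosed X) : Set X)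
    rw [coe_sInf, coe_sInf, ho.preimage_closure_eq_closure_preimage hf,
      ho.preimage_interior_eq_interior_preimage hf, preimage_iInter₂, biInter_image]
    rfl
  map_sSup' S := by
    refine SetLike.coe_injective ?_
    change f ⁻¹' ((sSup S : RegularClosed Y) : Set Y) = ((sSup _ : RegularClosed X) : Set X)
    rw [coe_sSup, coe_sSup, ho.preimage_closure_eq_closure_preimage hf, preimage_iUnion₂,
      biUnion_image]
    simp_rw [ho.preimage_interior_eq_interior_preimage hf]
    rfl

/-- The image of a regular closed set under an open map of a compact space is regular closed. -/
theorem closure_interior_image [CompactSpace X] [T2Space Y] (f : X → Y) (hf : Continuous f)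
    (ho : IsOpenMap f) (F : RegularClosed X) : closure (interior (f '' F)) = f '' F := by
  have hc : IsClosed (f '' (F : Set X)) := (F.isClosed.isCompact.image hf).isClosed
  refine subset_antisymm (closure_interior_subset hc) ?_
  calc f '' F = f '' closure (interior F) := by rw [F.closure_interior]
    _ ⊆ closure (f '' interior F) := image_closure_subset_closure_image hf
    _ ⊆ closure (interior (f '' F)) :=
      closure_mono (interior_maximal (image_mono interior_subset) (ho _ isOpen_interior))

/-- Turns (CO) for a preimage map into a triviality: if `F` meets `f '' G`, then `f ⁻¹' F` meets
`G`. -/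
theorem coe_lowerAdj_preimage [CompactSpace X] [T2Space Y] (f : X → Y) (hf : Continuous f)
    (ho : IsOpenMap f) (F : RegularClosed X) :
    ((lowerAdj (preimage f hf ho) F : RegularClosed Y) : Set Y) = f '' F := by
  have h : lowerAdj (preimage f hf ho) F =
      (⟨f '' F, closure_interior_image f hf ho F⟩ : RegularClosed Y) := by
    refine eq_of_forall_ge_iff fun G => ?_
    rw [gc_lowerAdj (preimage f hf ho) F G]
    change (F : Set X) ⊆ f ⁻¹' G ↔ f '' F ⊆ G
    exact image_subset_iff.symm
  rw [h]
  rfl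

end RegularClosed

/-! ### Clans, and the open map induced by a morphism. -/

/-- A clan in a contact algebra: a grill of pairwise contacting elements. -/
structure IsClan {B : Type u} [BooleanAlgebra B] (C : B → B → Prop) (Γ : Set B) : Prop where
  top_mem : ⊤ ∈ Γ
  sup_mem_iff : ∀ a b : B, a ⊔ b ∈ Γ ↔ a ∈ Γ ∨ b ∈ Γ
  contact : ∀ a ∈ Γ, ∀ b ∈ Γ, C a b

namespace IsClan

variable {B : Type u} [BooleanAlgebra B] {C : B → B → Prop} {Γ : Set B}

theorem mono (h : IsClan C Γ) {a b : B} (hab : a ≤ b) (ha : a ∈ Γ) : b ∈ Γ := by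
  rw [← sup_eq_right.2 hab, h.sup_mem_iff]
  exact Or.inl ha

theorem mem_or_compl_mem (h : IsClan C Γ) (a : B) : a ∈ Γ ∨ aᶜ ∈ Γ := by
  rw [← h.sup_mem_iff, sup_compl_eq_top]
  exact h.top_mem

theorem bot_notMem (h : IsClan C Γ) (hC : IsContact C) : ⊥ ∉ Γ := fun hb =>
  (hC.ne_bot _ _ (h.contact _ hb _ hb)).1 rfl

end IsClan

namespace RegularClosed

open Set

variable {X Y : Type u} [TopologicalSpace X] [TopologicalSpace Y]

/-- Otherwise each `y` has a regular closed neighbourhood `G y` disjoint from a member of `Γ`, hence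
outside `Γ`. Finitely many `G y` cover the space, so their join `⊤` would also be outside `Γ`. -/
theorem exists_mem_of_isClan [CompactSpace Y] [T2Space Y] {Γ : Set (RegularClosed Y)}
    (h : IsClan Contact Γ) : ∃ y, ∀ F ∈ Γ, y ∈ F := by
  by_contra! hne
  choose F hFΓ hF using hne
  choose G hyG hGF using fun y => exists_subset_of_mem_isOpen (F y).isClosed.isOpen_compl (hF y)
  have hG : ∀ y, G y ∉ Γ := fun y hy =>
    let ⟨_, hz, hz'⟩ := h.contact _ hy _ (hFΓ y)
    hGF y hz hz'
  obtain ⟨t, ht⟩ := isCompact_univ.elim_finite_subcover (fun y => interior (G y : Set Y))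
    (fun _ => isOpen_interior) fun y _ => mem_iUnion.2 ⟨y, hyG y⟩
  have hsup : ∀ t : Finset Y, t.sup G ∉ Γ := by
    classical
    intro t
    induction t using Finset.induction_on with
    | empty => exact h.bot_notMem isNormalContact_contact.toIsContact
    | insert y t _ ih =>
      rw [Finset.sup_insert, h.sup_mem_iff]
      exact not_or.2 ⟨hG y, ih⟩
  refine hsup t (h.mono (a := ⊤) (fun y _ => ?_) h.top_mem)
  obtain ⟨z, hz, hyz⟩ := mem_iUnion₂.1 (ht (mem_univ y))
  exact (Finset.le_sup hz : G z ≤ t.sup G) (interior_subset hyz)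

theorem isClan_of_contact_of_map {φ : CompleteLatticeHom (RegularClosed Y) (RegularClosed X)}
    (hφ : ∀ F G, Contact (φ F) (φ G) → Contact F G) (x : X) :
    IsClan Contact {F : RegularClosed Y | x ∈ φ F} where
  top_mem := by
    rw [mem_ofPred_eq, map_top]
    exact mem_top x
  sup_mem_iff F G := by
    rw [mem_ofPred_eq, map_sup]
    rfl
  contact F hF G hG := hφ F G ⟨x, hF, hG⟩

/-- If `f x` is interior to `F`, then `x ∉ φ Fᶜ`. The complement of `φ Fᶜ` is an open neighbourhood
of `x` contained in `φ F`, so `f` maps it into `F`. -/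
theorem continuous_of_mem_of_mem [CompactSpace Y] [T2Space Y]
    {φ : CompleteLatticeHom (RegularClosed Y) (RegularClosed X)} {f : X → Y}
    (hf : ∀ x, ∀ F, x ∈ φ F → f x ∈ F) : Continuous f := by
  refine continuous_iff_continuousAt.2 fun x => ?_
  rw [ContinuousAt, (nhds_basis_opens (f x)).tendsto_right_iff]
  rintro V ⟨hxV, hV⟩
  obtain ⟨F, hxF, hFV⟩ := exists_subset_of_mem_isOpen hV hxV
  have hx : x ∉ φ Fᶜ := fun h => mem_compl.1 (hf x _ h) hxF
  filter_upwards [(φ Fᶜ).isClosed.isOpen_compl.mem_nhds hx] with z hz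
  refine hFV (hf z F ?_)
  have : z ∈ φ F ⊔ φ Fᶜ := by
    rw [← map_sup, sup_compl_eq_top, map_top]
    exact mem_top z
  exact (mem_sup.1 this).resolve_right hz

/-- If `x ∉ φ F`, take a neighbourhood `G` of `x` missing `φ F`. Since `G ≤ φ (lowerAdj φ G)`, the
point `f x` would put `F` in contact with `lowerAdj φ G`, and (CO) would make `φ F` meet `G`. -/
theorem mem_iff_of_mem_of_mem [CompactSpace X] [T2Space X]
    {φ : CompleteLatticeHom (RegularClosed Y) (RegularClosed X)} {f : X → Y}
    (hf : ∀ x, ∀ F, x ∈ φ F → f x ∈ F)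
    (hφ : ∀ F G, Contact F (lowerAdj φ G) → Contact (φ F) G) (x : X) (F : RegularClosed Y) :
    x ∈ φ F ↔ f x ∈ F := by
  refine ⟨hf x F, fun hx => ?_⟩
  by_contra hxF
  obtain ⟨G, hxG, hGF⟩ := exists_subset_of_mem_isOpen (φ F).isClosed.isOpen_compl hxF
  have hle : G ≤ φ (lowerAdj φ G) := (gc_lowerAdj φ).le_u_l G
  obtain ⟨z, hzF, hzG⟩ := hφ F G ⟨f x, hx, hf x _ (hle (interior_subset hxG))⟩
  exact hGF hzG hzF

theorem image_eq_lowerAdj [CompactSpace X] [CompactSpace Y] [T2Space Y]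
    {φ : CompleteLatticeHom (RegularClosed Y) (RegularClosed X)} {f : X → Y}
    (hc : Continuous f) (hf : ∀ x, ∀ F, x ∈ φ F ↔ f x ∈ F)
    (hφ : ∀ F G, Contact F (lowerAdj φ G) → Contact (φ F) G) (G : RegularClosed X) :
    f '' G = ((lowerAdj φ G : RegularClosed Y) : Set Y) := by
  have hle : G ≤ φ (lowerAdj φ G) := (gc_lowerAdj φ).le_u_l G
  refine subset_antisymm (image_subset_iff.2 fun x hx => (hf x _).1 (hle hx)) fun y hy => ?_
  by_contra hyG
  obtain ⟨F, hyF, hFG⟩ := exists_subset_of_mem_isOpen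
    (G.isClosed.isCompact.image hc).isClosed.isOpen_compl hyG
  obtain ⟨z, hzF, hzG⟩ := hφ F G ⟨y, interior_subset hyF, hy⟩
  exact hFG ((hf z F).1 hzF) (mem_image_of_mem f hzG)

/-- The image of `G` is the regular closed set `lowerAdj φ G`. If `f x` were not interior to it, `f
x` would lie in its Boolean complement, so `x` would not be interior to `φ (lowerAdj φ G) ≥ G`. -/
theorem isOpenMap_of_mem_iff [CompactSpace X] [T2Space X] [CompactSpace Y] [T2Space Y]
    {φ : CompleteLatticeHom (RegularClosed Y) (RegularClosed X)} {f : X → Y}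
    (hc : Continuous f) (hf : ∀ x, ∀ F, x ∈ φ F ↔ f x ∈ F)
    (hφ : ∀ F G, Contact F (lowerAdj φ G) → Contact (φ F) G) : IsOpenMap f := by
  refine isOpenMap_iff_nhds_le.2 fun x => ?_
  rw [((nhds_basis_opens x).map f).ge_iff]
  rintro U ⟨hxU, hU⟩
  obtain ⟨G, hxG, hGU⟩ := exists_subset_of_mem_isOpen hU hxU
  refine Filter.mem_of_superset (mem_interior_iff_mem_nhds.1 ?_) (image_mono hGU)
  by_contra hx
  rw [image_eq_lowerAdj hc hf hφ, ← mem_compl, ← hf, map_compl', mem_compl] at hx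
  exact hx (interior_mono ((gc_lowerAdj φ).le_u_l G) hxG)

theorem exists_eq_preimage [CompactSpace X] [T2Space X] [CompactSpace Y] [T2Space Y]
    (φ : CompleteLatticeHom (RegularClosed Y) (RegularClosed X))
    (hF : ∀ F G, Contact (φ F) (φ G) → Contact F G)
    (hφ : ∀ F G, Contact F (lowerAdj φ G) → Contact (φ F) G) :
    ∃ (f : X → Y) (hc : Continuous f) (ho : IsOpenMap f), φ = preimage f hc ho := by
  choose f hf using fun x => exists_mem_of_isClan (isClan_of_contact_of_map hF x)
  have hc := continuous_of_mem_of_mem hf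
  have hf' := mem_iff_of_mem_of_mem hf hφ
  exact ⟨f, hc, isOpenMap_of_mem_iff hc hf' hφ, DFunLike.ext _ _ fun F => SetLike.ext fun x => hf' x F⟩

end RegularClosed

/-! ### The functor, and its full faithfulness. -/

/-- The complete normal contact algebra of regular closed sets. -/
def CompHaus.regularClosed (X : CompHaus.{u}) : CNCA.{u} where
  carrier := RegularClosed X
  contact := RegularClosed.Contact
  isNormalContact := RegularClosed.isNormalContact_contact

/-- The contravariant functor sending a compact Hausdorff space to its regular closed sets, and
an open map to the preimage map. -/
def OpC.regularClosed : OpC.{u}ᵒᵖ ⥤ DOpC.{u} where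
  obj X := ⟨CompHaus.regularClosed X.unop.obj⟩
  map {X Y} f :=
    { hom :=
        { toHom := RegularClosed.preimage f.unop.hom f.unop.hom.hom.hom.continuous f.unop.property
          contact_of_map := fun _ _ ⟨x, hx, hx'⟩ => ⟨f.unop.hom x, hx, hx'⟩ }
      property := by
        rintro F G ⟨y, hyF, hyG⟩
        have hyG' := (RegularClosed.coe_lowerAdj_preimage f.unop.hom
          f.unop.hom.hom.hom.continuous f.unop.property G).subset hyG
        obtain ⟨x, hx, rfl⟩ := hyG'
        exact ⟨x, hyF, hx⟩ }
  map_id X := rfl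
  map_comp f g := rfl

instance : OpC.regularClosed.{u}.Faithful where
  map_injective {X Y} f g h := by
    refine Quiver.Hom.unop_inj (WideSubcategory.hom_ext _ (ConcreteCategory.hom_ext _ _ fun x => ?_))
    refine RegularClosed.eq_of_forall_mem_imp fun F hF => ?_
    have h' : RegularClosed.preimage f.unop.hom f.unop.hom.hom.hom.continuous f.unop.property =
        RegularClosed.preimage g.unop.hom g.unop.hom.hom.hom.continuous g.unop.property :=
      congrArg (fun k => FedorchukHom.toHom k.hom) h
    exact (SetLike.ext_iff.1 (DFunLike.congr_fun h' F) x).1 hF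

instance : OpC.regularClosed.{u}.Full where
  map_surjective {X Y} φ := by
    obtain ⟨f, hc, ho, h⟩ := RegularClosed.exists_eq_preimage
      (X := Y.unop.obj) (Y := X.unop.obj) (FedorchukHom.toHom φ.hom)
      (FedorchukHom.contact_of_map φ.hom) φ.property
    let g : Y.unop ⟶ X.unop := ⟨CompHausLike.ofHom _ ⟨f, hc⟩, ho⟩
    exact ⟨g.op, WideSubcategory.hom_ext _ (FedorchukHom.ext h.symm)⟩

/-! ### Existence of clans in an abstract contact algebra. -/

namespace IsContact

variable {B : Type u} [BooleanAlgebra B] {C : B → B → Prop}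

theorem mono_right (hC : IsContact C) {a b c : B} (hbc : b ≤ c) (h : C a b) : C a c := by
  rw [← sup_eq_right.2 hbc, hC.sup_right]
  exact Or.inl h

theorem mono (hC : IsContact C) {a b c d : B} (hab : a ≤ b) (hcd : c ≤ d) (h : C a c) : C b d :=
  hC.mono_right hcd (hC.symm _ _ (hC.mono_right hab (hC.symm _ _ h)))

theorem of_inf_ne_bot (hC : IsContact C) {a b : B} (h : a ⊓ b ≠ ⊥) : C a b :=
  hC.mono inf_le_left inf_le_right (hC.refl_of_ne_bot _ h)

open Order in
/-- An ideal not containing `a` extends to a prime ideal not containing `a`. -/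
theorem exists_isPrime_notMem {I : Ideal B} {a : B} (ha : a ∉ I) :
    ∃ J : Ideal B, J.IsPrime ∧ I ≤ J ∧ a ∉ J := by
  obtain ⟨J, hJ, hIJ, hd⟩ := DistribLattice.prime_ideal_of_disjoint_filter_ideal
    (F := PFilter.principal a) (I := I)
    (Set.disjoint_left.2 fun x hx hxI => ha (I.lower (PFilter.mem_principal.1 hx) hxI))
  exact ⟨J, hJ, hIJ, fun h => Set.disjoint_left.1 hd (PFilter.mem_principal.2 le_rfl) h⟩

open Order in
theorem inf_ne_bot_of_notMem {J : Ideal B} (hJ : J.IsPrime) {a b : B} (ha : a ∉ J)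
    (hb : b ∉ J) : a ⊓ b ≠ ⊥ := fun h =>
  (hJ.mem_or_mem (h ▸ J.bot_mem : a ⊓ b ∈ J)).elim ha hb

open Order in
/-- Elements in contact lie in a common clan. -/
theorem exists_isClan (hC : IsContact C) {a b : B} (hab : C a b) :
    ∃ Γ, IsClan C Γ ∧ a ∈ Γ ∧ b ∈ Γ := by
  let I : Ideal B :=
    { carrier := {x | ¬ C x b}
      lower' := fun x y hyx hx hy => hx (hC.mono hyx le_rfl hy)
      nonempty' := ⟨⊥, fun h => (hC.ne_bot _ _ h).1 rfl⟩
      directed' := fun x hx y hy => ⟨x ⊔ y, fun h =>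
        ((hC.sup_right _ _ _).1 (hC.symm _ _ h)).elim (fun h => hx (hC.symm _ _ h))
          fun h => hy (hC.symm _ _ h), le_sup_left, le_sup_right⟩ }
  -- The complement of `J` is an ultrafilter containing `a`, all of whose members are in contact
  -- with `b`.
  obtain ⟨J, hJ, hIJ, haJ⟩ := exists_isPrime_notMem (I := I) (a := a) (fun h => h hab)
  have hJb : ∀ x, x ∉ J → C x b := fun x hx => by
    by_contra h
    exact hx (hIJ h)
  let K : Ideal B :=
    { carrier := {y | ∃ x, x ∉ J ∧ ¬ C x y}
      lower' := fun y z hzy ⟨x, hx, h⟩ => ⟨x, hx, fun h' => h (hC.mono_right hzy h')⟩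
      nonempty' := ⟨⊥, a, haJ, fun h => (hC.ne_bot _ _ h).2 rfl⟩
      directed' := fun y ⟨x, hx, h⟩ y' ⟨x', hx', h'⟩ => ⟨y ⊔ y', ⟨x ⊓ x', fun hm =>
        (hJ.mem_or_mem hm).elim hx hx', fun hc => ((hC.sup_right _ _ _).1 hc).elim
          (fun hc => h (hC.mono inf_le_left le_rfl hc))
          fun hc => h' (hC.mono inf_le_right le_rfl hc)⟩, le_sup_left, le_sup_right⟩ }
  -- The complement of `L` is an ultrafilter containing `b`, in contact with the one off `J` member
  -- by member; the union of the two is the clan.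
  obtain ⟨L, hL, hKL, hbL⟩ := exists_isPrime_notMem (I := K) (a := b)
    (fun ⟨x, hx, h⟩ => h (hJb x hx))
  have hJL : ∀ x, x ∉ J → ∀ y, y ∉ L → C x y := fun x hx y hy => by
    by_contra h
    exact hy (hKL ⟨x, hx, h⟩)
  refine ⟨{x | x ∉ J ∨ x ∉ L}, ⟨?_, ?_, ?_⟩, Or.inl haJ, Or.inr hbL⟩
  · exact Or.inl fun h => haJ (J.lower le_top h)
  · intro x y
    simp only [Set.mem_ofPred_eq, Ideal.sup_mem_iff]
    tauto
  · rintro x (hx | hx) y (hy | hy)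
    · exact hC.of_inf_ne_bot (inf_ne_bot_of_notMem hJ hx hy)
    · exact hJL x hx y hy
    · exact hC.symm _ _ (hJL y hy x hx)
    · exact hC.of_inf_ne_bot (inf_ne_bot_of_notMem hL hx hy)

end IsContact

/-! ### The compact Hausdorff space of clusters. -/

/-- A cluster is a clan containing every element in contact with all its members. -/
@[ext]
structure Cluster {B : Type u} [BooleanAlgebra B] (C : B → B → Prop) : Type u where
  /-- The underlying set. -/
  carrier : Set B
  isClan : IsClan C carrier
  mem_of_contact : ∀ a, (∀ b ∈ carrier, C a b) → a ∈ carrier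

namespace Cluster

open Set

variable {B : Type u} [BooleanAlgebra B] {C : B → B → Prop}

instance : SetLike (Cluster C) B where
  coe := carrier
  coe_injective _ _ h := Cluster.ext h

/-- The cluster generated by a clan. -/
def ofIsClan (hC : IsNormalContact C) {Γ : Set B} (h : IsClan C Γ) : Cluster C where
  carrier := {a | ∀ b ∈ Γ, C a b}
  isClan :=
    { top_mem := fun b hb => hC.symm _ _ (hC.mono_right le_top (h.contact b hb b hb))
      sup_mem_iff := by
        refine fun a b => ⟨fun hab => ?_, fun hab g hg => ?_⟩
        · by_contra! hn
          simp only [mem_ofPred_eq, not_forall] at hn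
          obtain ⟨⟨g, hg, hag⟩, g', hg', hbg⟩ := hn
          obtain ⟨c, hac, hgc⟩ := hC.interpolate a g hag
          obtain ⟨d, hbd, hgd⟩ := hC.interpolate b g' hbg
          -- A clan need not be closed under meets, but neither `cᶜ` nor `dᶜ` lies in `Γ`, hence nor
          -- does their join; so `c ⊓ d ∈ Γ`, and it must be in contact with `a ⊔ b`.
          have hcd : (c ⊓ d)ᶜ ∉ Γ := by
            rw [compl_inf, h.sup_mem_iff]
            exact not_or.2 ⟨fun hm => hgc (h.contact _ hg _ hm),
              fun hm => hgd (h.contact _ hg' _ hm)⟩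
          have := hC.symm _ _ (hab _ ((h.mem_or_compl_mem _).resolve_right hcd))
          rcases (hC.sup_right _ _ _).1 this with h1 | h1
          · exact hac (hC.symm _ _ (hC.mono inf_le_left le_rfl h1))
          · exact hbd (hC.symm _ _ (hC.mono inf_le_right le_rfl h1))
        · exact hab.elim (fun ha => hC.mono le_sup_left le_rfl (ha g hg))
            fun hb => hC.mono le_sup_right le_rfl (hb g hg)
      contact := by
        intro a ha b hb
        by_contra hab
        obtain ⟨c, hac, hbc⟩ := hC.interpolate a b hab
        exact (h.mem_or_compl_mem c).elim (fun hc => hac (ha c hc)) fun hc => hbc (hb _ hc) }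
  mem_of_contact a ha b hb := ha b fun c hc => h.contact b hb c hc

theorem subset_ofIsClan (hC : IsNormalContact C) {Γ : Set B} (h : IsClan C Γ) {a : B}
    (ha : a ∈ Γ) : a ∈ ofIsClan hC h := fun b hb => h.contact a ha b hb

theorem exists_mem_mem_iff (hC : IsNormalContact C) {a b : B} :
    (∃ σ : Cluster C, a ∈ σ ∧ b ∈ σ) ↔ C a b := by
  refine ⟨fun ⟨σ, ha, hb⟩ => σ.isClan.contact a ha b hb, fun h => ?_⟩
  obtain ⟨Γ, hΓ, ha, hb⟩ := hC.exists_isClan h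
  exact ⟨ofIsClan hC hΓ, subset_ofIsClan hC hΓ ha, subset_ofIsClan hC hΓ hb⟩

theorem mem_sup {σ : Cluster C} {a b : B} : a ⊔ b ∈ σ ↔ a ∈ σ ∨ b ∈ σ := σ.isClan.sup_mem_iff a b

theorem mem_mono {σ : Cluster C} {a b : B} (hab : a ≤ b) (ha : a ∈ σ) : b ∈ σ :=
  σ.isClan.mono hab ha

theorem compl_mem_of_notMem {σ : Cluster C} {a : B} (ha : a ∉ σ) : aᶜ ∈ σ :=
  (σ.isClan.mem_or_compl_mem a).resolve_left ha

theorem eq_top_of_forall_mem (hC : IsNormalContact C) {a : B} (h : ∀ σ : Cluster C, a ∈ σ) :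
    a = ⊤ := by
  by_contra ha
  obtain ⟨c, hc, hca⟩ := hC.exists_ne_bot a ha
  obtain ⟨σ, hσ, -⟩ := (exists_mem_mem_iff hC).2 (hC.refl_of_ne_bot c hc)
  exact hca (σ.isClan.contact _ hσ _ (h σ))

/-- By (C6) only `⊤` lies in every cluster; this is applied to `b ⊔ aᶜ`. -/
theorem le_of_forall_mem_imp (hC : IsNormalContact C) {a b : B}
    (h : ∀ σ : Cluster C, a ∈ σ → b ∈ σ) : a ≤ b := by
  rw [← himp_eq_top_iff, himp_eq]
  refine eq_top_of_forall_mem hC fun σ => mem_sup.2 ?_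
  by_cases ha : a ∈ σ
  · exact Or.inl (h σ ha)
  · exact Or.inr (compl_mem_of_notMem ha)

instance : TopologicalSpace (Cluster C) :=
  TopologicalSpace.generateFrom (range fun a => {σ | a ∉ σ})

theorem isTopologicalBasis (hC : IsContact C) :
    TopologicalSpace.IsTopologicalBasis (range fun a => {σ : Cluster C | a ∉ σ}) where
  exists_subset_inter := by
    rintro _ ⟨a, rfl⟩ _ ⟨b, rfl⟩ σ ⟨ha, hb⟩
    refine ⟨_, ⟨a ⊔ b, rfl⟩, fun h => (mem_sup.1 h).elim ha hb, fun τ hτ => ?_⟩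
    exact ⟨fun h => hτ (mem_sup.2 (Or.inl h)), fun h => hτ (mem_sup.2 (Or.inr h))⟩
  sUnion_eq := eq_univ_of_forall fun σ =>
    mem_sUnion.2 ⟨_, ⟨⊥, rfl⟩, σ.isClan.bot_notMem hC⟩
  eq_generateFrom := rfl

theorem isOpen_notMem (a : B) : IsOpen {σ : Cluster C | a ∉ σ} :=
  TopologicalSpace.isOpen_generateFrom_of_mem ⟨a, rfl⟩

theorem isClosed_mem (a : B) : IsClosed {σ : Cluster C | a ∈ σ} :=
  ⟨isOpen_notMem a⟩

theorem exists_notMem_subset (hC : IsContact C) {U : Set (Cluster C)} (hU : IsOpen U)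
    {σ : Cluster C} (hσ : σ ∈ U) : ∃ a, a ∉ σ ∧ ∀ τ : Cluster C, a ∉ τ → τ ∈ U := by
  obtain ⟨_, ⟨a, rfl⟩, ha, haU⟩ := (isTopologicalBasis hC).exists_subset_of_mem_open hσ hU
  exact ⟨a, ha, haU⟩

/-- Distinct clusters contain elements `a`, `b` not in contact. The `c` given by (C5) yields
disjoint open sets, because every cluster contains `c` or `cᶜ`. -/
theorem t2Space (hC : IsNormalContact C) : T2Space (Cluster C) := by
  refine ⟨fun σ τ hστ => ?_⟩
  have : ∃ a ∈ σ, a ∉ τ := by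
    by_contra! h
    refine hστ (SetLike.coe_injective (subset_antisymm h fun b hb => ?_))
    exact σ.mem_of_contact b fun a ha => τ.isClan.contact _ hb _ (h a ha)
  obtain ⟨a, haσ, haτ⟩ := this
  have : ∃ b ∈ τ, ¬ C a b := by
    by_contra! h
    exact haτ (τ.mem_of_contact a h)
  obtain ⟨b, hbτ, hab⟩ := this
  obtain ⟨c, hac, hbc⟩ := hC.interpolate a b hab
  refine ⟨_, _, isOpen_notMem c, isOpen_notMem cᶜ,
    fun hc => hac (σ.isClan.contact _ haσ _ hc), fun hc => hbc (τ.isClan.contact _ hbτ _ hc), ?_⟩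
  exact disjoint_left.2 fun ρ hρ hρ' => hρ' (compl_mem_of_notMem hρ)

/-- The elements belonging to `U`-almost every cluster form a clan, and `U` converges to the cluster
this clan generates. -/
theorem compactSpace (hC : IsNormalContact C) : CompactSpace (Cluster C) := by
  refine ⟨isCompact_iff_ultrafilter_le_nhds.2 fun U _ => ?_⟩
  have h : IsClan C {a | ∀ᶠ σ : Cluster C in U, a ∈ σ} :=
    { top_mem := Filter.Eventually.of_forall fun σ => σ.isClan.top_mem
      sup_mem_iff := fun a b => by
        simp only [mem_ofPred_eq, mem_sup, Ultrafilter.eventually_or]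
      contact := fun a ha b hb => by
        obtain ⟨σ, ha, hb⟩ := (Filter.Eventually.and ha hb).exists
        exact σ.isClan.contact a ha b hb }
  refine ⟨ofIsClan hC h, mem_univ _, ?_⟩
  rw [((isTopologicalBasis hC.toIsContact).nhds_hasBasis).ge_iff]
  rintro _ ⟨⟨a, rfl⟩, ha⟩
  exact Ultrafilter.eventually_not.2 fun h' => ha (subset_ofIsClan hC h h')

/-- If the basic open set of `b` misses that of `a`, every cluster contains `a` or `b`. Then `b ⊔ a
= ⊤`, so `aᶜ ≤ b`, and a cluster containing `aᶜ` contains `b`. -/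
theorem closure_notMem (hC : IsNormalContact C) (a : B) :
    closure {σ : Cluster C | a ∉ σ} = {σ | aᶜ ∈ σ} := by
  refine subset_antisymm (closure_minimal (fun σ => compl_mem_of_notMem) (isClosed_mem _))
    fun σ hσ => ?_
  rw [mem_closure_iff]
  intro U hU hσU
  obtain ⟨b, hb, hbU⟩ := exists_notMem_subset hC.toIsContact hU hσU
  by_contra! hne
  have hab : b ⊔ a = ⊤ := eq_top_of_forall_mem hC fun τ => mem_sup.2 <| by
    by_contra! hτ
    exact hne.subset ⟨hbU τ hτ.1, hτ.2⟩
  refine hb (mem_mono ?_ hσ)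
  rw [← himp_eq_top_iff, himp_eq, compl_compl, hab]

/-- The regular closed set of all clusters containing `a`. -/
def regularClosed (hC : IsNormalContact C) (a : B) : RegularClosed (Cluster C) where
  carrier := {σ | a ∈ σ}
  closure_interior' := by
    have h := (RegularClosed.ofIsOpen _ (isOpen_notMem (C := C) aᶜ)).closure_interior
    rw [RegularClosed.coe_ofIsOpen, closure_notMem hC, compl_compl] at h
    exact h

theorem regularClosed_le_iff (hC : IsNormalContact C) {a b : B} :
    regularClosed hC a ≤ regularClosed hC b ↔ a ≤ b :=
  ⟨fun h => le_of_forall_mem_imp hC fun _ hσ => h hσ, fun h _ hσ => mem_mono h hσ⟩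

theorem regularClosed_compl (hC : IsNormalContact C) (a : B) :
    regularClosed hC aᶜ = (regularClosed hC a)ᶜ :=
  SetLike.coe_injective (closure_notMem hC a).symm

theorem contact_regularClosed_iff (hC : IsNormalContact C) {a b : B} :
    (regularClosed hC a).Contact (regularClosed hC b) ↔ C a b :=
  exists_mem_mem_iff hC

end Cluster

/-! ### Representation of complete algebras, and essential surjectivity. -/

namespace Cluster

open Set

variable {B : Type u} [CompleteBooleanAlgebra B] {C : B → B → Prop}

theorem regularClosed_surjective (hC : IsNormalContact C) :
    Function.Surjective (regularClosed hC) := by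
  intro F
  -- Completeness is needed for this join. If `σ ∉ F`, some `c ∉ σ` lies in every cluster of `F`, so
  -- `c` bounds the join; conversely, `interior F` is a union of basic sets whose closures are
  -- represented by elements of the joined family.
  refine ⟨sSup {b | regularClosed hC b ≤ F}, le_antisymm (fun σ hσ => ?_) ?_⟩
  · by_contra hσF
    obtain ⟨c, hc, hcF⟩ := exists_notMem_subset hC.toIsContact F.isClosed.isOpen_compl hσF
    refine hc (mem_mono (sSup_le fun b hb => ?_) hσ)
    refine (regularClosed_le_iff hC).1 (hb.trans fun τ hτ => ?_)
    by_contra hcτ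
    exact hcF τ hcτ hτ
  · rw [RegularClosed.le_def, ← F.closure_interior]
    refine closure_minimal (fun σ hσ => ?_) (RegularClosed.isClosed _)
    obtain ⟨c, hc, hcF⟩ := exists_notMem_subset hC.toIsContact isOpen_interior hσ
    have hle : regularClosed hC cᶜ ≤ F := by
      rw [RegularClosed.le_def, regularClosed_compl]
      exact closure_minimal (fun τ hτ => interior_subset (hcF τ hτ)) F.isClosed
    exact mem_mono (le_sSup hle) (compl_mem_of_notMem hc)

/-- A complete normal contact algebra is isomorphic to the regular closed sets of clusters. -/
noncomputable def orderIso (hC : IsNormalContact C) : B ≃o RegularClosed (Cluster C) :=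
  OrderIso.ofSurjective (OrderEmbedding.ofMapLEIff _ fun _ _ => regularClosed_le_iff hC)
    (regularClosed_surjective hC)

theorem contact_orderIso_iff (hC : IsNormalContact C) {a b : B} :
    (orderIso hC a).Contact (orderIso hC b) ↔ C a b :=
  contact_regularClosed_iff hC

end Cluster

theorem lowerAdj_orderIso {A B : Type u} [CompleteBooleanAlgebra A] [CompleteBooleanAlgebra B]
    (e : A ≃o B) (b : B) : lowerAdj (CompleteLatticeHom.OrderIso.toCompleteLatticeHom e) b = e.symm b :=
  eq_of_forall_ge_iff fun a => by
    rw [gc_lowerAdj (CompleteLatticeHom.OrderIso.toCompleteLatticeHom e) b a]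
    exact (e.symm_apply_le).symm

/-- An order isomorphism preserving and reflecting contact, as a morphism of `DOpC`. -/
def DOpC.homOfOrderIso {A B : CNCA.{u}} (e : A.carrier ≃o B.carrier)
    (he : ∀ a b, B.contact (e a) (e b) ↔ A.contact a b) : (⟨A⟩ : DOpC.{u}) ⟶ ⟨B⟩ where
  hom := ⟨CompleteLatticeHom.OrderIso.toCompleteLatticeHom e, fun a b => (he a b).1⟩
  property a b h := by
    have h' : A.contact a (lowerAdj (CompleteLatticeHom.OrderIso.toCompleteLatticeHom e) b) := h
    rw [lowerAdj_orderIso, ← he, e.apply_symm_apply] at h'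
    exact h'

/-- An order isomorphism preserving and reflecting contact, as an isomorphism of `DOpC`. -/
def DOpC.isoOfOrderIso {A B : CNCA.{u}} (e : A.carrier ≃o B.carrier)
    (he : ∀ a b, B.contact (e a) (e b) ↔ A.contact a b) : (⟨A⟩ : DOpC.{u}) ≅ ⟨B⟩ where
  hom := homOfOrderIso e he
  inv := homOfOrderIso e.symm fun a b => by
    rw [← he, e.apply_symm_apply, e.apply_symm_apply]
  hom_inv_id := WideSubcategory.hom_ext _
    (FedorchukHom.ext (DFunLike.ext _ _ fun a => e.symm_apply_apply a))
  inv_hom_id := WideSubcategory.hom_ext _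
    (FedorchukHom.ext (DFunLike.ext _ _ fun b => e.apply_symm_apply b))

instance : OpC.regularClosed.{u}.EssSurj where
  mem_essImage := fun ⟨A⟩ => by
    have := Cluster.t2Space A.isNormalContact
    have := Cluster.compactSpace A.isNormalContact
    let X : OpC.{u} := ⟨CompHaus.of (Cluster A.contact)⟩
    exact ⟨.op X, ⟨(DOpC.isoOfOrderIso (B := CompHaus.regularClosed X.obj)
      (Cluster.orderIso A.isNormalContact)
      fun _ _ => Cluster.contact_orderIso_iff A.isNormalContact).symm⟩⟩

/-- The categories `OpC` and `DOpC` are dually equivalent. -/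
theorem theorem2p19 : Nonempty (OpC.{u}ᵒᵖ ≌ DOpC.{u}) := by
  have : OpC.regularClosed.{u}.IsEquivalence := {}
  exact ⟨OpC.regularClosed.asEquivalence⟩
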